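/- For real $\alpha,\beta$ and $|t|<1$ let $$F(\alpha,\beta;1;t)=\sum_{n=0}^{\infty}\frac{(\alpha,n)(\beta,n)}{(1,n)}\frac{t^n}{n!},$$ where $(\alpha,0)=1$, $(\alpha,n)=\alpha(\alpha+1)\cdots(\alpha+n-1)$ for $n\ge 1$ (so $(1,n)=n!$), be the Gaussian hypergeometric function. For $a,b>0$ define $$a_0=a,\quad b_0=b,\quad a_{n+1}=\frac{a_n+2b_n}{3},\qquad b_{n+1}=\sqrt[3]{\frac{b_n(a_n^2+a_nb_n+b_n^2)}{3}}.$$ Let $x\in(0,1)$. When $a=x$ and $b=1$, the sequences $(a_n)$ and $(b_n)$ converge to a common limit $F(x,1)>0$, and $$\frac{1}{F(x,1)}=\sum_{n=0}^{\infty}\frac{(1/3,n)^2}{(n!)^2}(1-x^3)^n=F\left(\tfrac13,\tfrac13;1;1-x^3\right).$$ In particular, for every $x\in(0,1)$, $$F\left(\tfrac13,\tfrac13;1;1-x^3\right)=\sqrt[3]{\frac{3}{x^2+x+1}}\;F\left(\tfrac13,\tfrac13;1;\frac{(1-x)^3}{9(x^2+x+1)}\right).$$ -/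

import Mathlib

open Filter Topology

/-- The pair `(aₙ, bₙ)` of the Borwein cubic AGM iteration started at `(a₀, b₀) = (a, b)`:
`aₙ₊₁ = (aₙ + 2 bₙ) / 3` and `bₙ₊₁ = (bₙ (aₙ² + aₙ bₙ + bₙ²) / 3) ^ (1/3)`.
For `a, b > 0` all terms are positive, so the real power is the cube root. -/
noncomputable def cubicAGMPair (a b : ℝ) : ℕ → ℝ × ℝ
  | 0 => (a, b)
  | n + 1 =>
    let p := cubicAGMPair a b n
    ((p.1 + 2 * p.2) / 3,
      (p.2 * (p.1 ^ 2 + p.1 * p.2 + p.2 ^ 2) / 3) ^ ((1 : ℝ) / 3))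

/-- The sequence `aₙ` of the iteration started at `(a, b)`. -/
noncomputable def cubicAGMSeqA (a b : ℝ) (n : ℕ) : ℝ := (cubicAGMPair a b n).1

/-- The sequence `bₙ` of the iteration started at `(a, b)`. -/
noncomputable def cubicAGMSeqB (a b : ℝ) (n : ℕ) : ℝ := (cubicAGMPair a b n).2

/-- The limit function `F(a, b)` of the iteration, defined as the limit of `aₙ`.
(That `aₙ` and `bₙ` really converge to this number has to be asserted separately.) -/
noncomputable def cubicAGM (a b : ℝ) : ℝ := limUnder atTop (cubicAGMSeqA a b)

/-! As with Gauss's AGM, the limit is found through an invariant: `cubicHyp (1 - (aₙ/bₙ)³) / bₙ`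
does not depend on `n` (`cubicHyp_seq_eq`). Both sequences tend to the same `M > 0`, so continuity
of `cubicHyp` at `0` turns the invariant into `1 / M`.

Invariance under one step is exactly the cubic transformation `cubicHyp_one_sub_cube_eq`. Its two
sides satisfy the self-adjoint equation `((1 - x³) y')' = x y` and equal `1` at the singular point
`x = 1`. Their weighted Wronskian is constant and vanishes at `1`, so their quotient is constant,
hence `1`. -/

/-! ### Power series with polynomially bounded coefficients -/

/-- A power series whose coefficients grow at most polynomially converges on the open unit
interval. -/
theorem summable_mul_pow_of_abs_le {a : ℕ → ℝ} {C : ℝ} {k : ℕ}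
    (ha : ∀ n, |a n| ≤ C * ((n : ℝ) + 1) ^ k) {z : ℝ} (hz : |z| < 1) :
    Summable fun n => a n * z ^ n := by
  rcases eq_or_ne z 0 with rfl | h0
  · refine summable_of_ne_finset_zero (s := {0}) fun n hn => ?_
    simp only [Finset.mem_singleton] at hn
    simp [hn]
  have hs : Summable fun n : ℕ => ((n : ℝ) ^ k * |z| ^ n) :=
    summable_pow_mul_geometric_of_norm_lt_one k (by simpa using hz)
  -- Shifting the index produces `(n + 1) ^ k`; the spare factor `|z|` is divided out, hence the
  -- separate case `z = 0`.
  have hs' := ((summable_nat_add_iff 1).2 hs).mul_left (C / |z|)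
  refine Summable.of_norm_bounded hs' fun n => ?_
  have hz0 : 0 < |z| := abs_pos.2 h0
  calc ‖a n * z ^ n‖ = |a n| * |z| ^ n := by simp
    _ ≤ C * ((n : ℝ) + 1) ^ k * |z| ^ n := by gcongr; exact ha n
    _ = C / |z| * (((n + 1 : ℕ) : ℝ) ^ k * |z| ^ (n + 1)) := by
      push_cast
      field_simp
      ring

/-- Polynomial growth of coefficients is inherited by the derived power series. -/
theorem abs_succ_mul_succ_le {a : ℕ → ℝ} {C : ℝ} {k : ℕ}
    (ha : ∀ n, |a n| ≤ C * ((n : ℝ) + 1) ^ k) (n : ℕ) :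
    |((n : ℝ) + 1) * a (n + 1)| ≤ (C * 2 ^ k) * ((n : ℝ) + 1) ^ (k + 1) := by
  have hC : 0 ≤ C := by simpa using (abs_nonneg _).trans (ha 0)
  have hn : (0 : ℝ) ≤ n := n.cast_nonneg
  rw [abs_mul, abs_of_nonneg (by positivity : (0 : ℝ) ≤ (n : ℝ) + 1)]
  have h1 : |a (n + 1)| ≤ C * ((n : ℝ) + 1 + 1) ^ k := by simpa using ha (n + 1)
  have h2 : ((n : ℝ) + 1 + 1) ^ k ≤ (2 * ((n : ℝ) + 1)) ^ k :=
    pow_le_pow_left₀ (by positivity) (by linarith) k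
  calc ((n : ℝ) + 1) * |a (n + 1)| ≤ ((n : ℝ) + 1) * (C * (2 * ((n : ℝ) + 1)) ^ k) := by
        gcongr
        exact h1.trans (by gcongr)
    _ = _ := by rw [mul_pow]; ring

/-- Termwise differentiation of a power series with polynomially growing coefficients. -/
theorem hasDerivAt_tsum_mul_pow {a : ℕ → ℝ} {C : ℝ} {k : ℕ}
    (ha : ∀ n, |a n| ≤ C * ((n : ℝ) + 1) ^ k) {z : ℝ} (hz : |z| < 1) :
    HasDerivAt (fun y => ∑' n, a n * y ^ n) (∑' n : ℕ, (((n : ℝ) + 1) * a (n + 1)) * z ^ n) z := by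
  obtain ⟨r, hzr, hr1⟩ := exists_between hz
  have hr0 : 0 < r := (abs_nonneg z).trans_lt hzr
  have habs : |r| < 1 := by rwa [abs_of_pos hr0]
  have hu : Summable fun n : ℕ => |a n * ((n : ℝ) * r ^ (n - 1))| := by
    rw [← summable_nat_add_iff 1]
    refine (summable_mul_pow_of_abs_le (abs_succ_mul_succ_le ha) habs).abs.congr fun n => ?_
    congr 1
    simp only [Nat.add_sub_cancel, Nat.cast_add, Nat.cast_one]
    ring
  have key := hasDerivAt_tsum_of_isPreconnected (t := Set.Ioo (-r) r) (y₀ := 0) (y := z)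
    (g := fun n y => a n * y ^ n) (g' := fun n y => a n * ((n : ℝ) * y ^ (n - 1))) hu isOpen_Ioo
    isPreconnected_Ioo (fun n y _ => (hasDerivAt_pow n y).const_mul (a n)) ?_ ?_
    (summable_mul_pow_of_abs_le ha (by simp)) ?_
  · have hs : Summable fun n : ℕ => a n * ((n : ℝ) * z ^ (n - 1)) := by
      rw [← summable_nat_add_iff 1]
      refine (summable_mul_pow_of_abs_le (abs_succ_mul_succ_le ha) hz).congr fun n => ?_
      simp only [Nat.add_sub_cancel, Nat.cast_add, Nat.cast_one]
      ring
    rw [hs.tsum_eq_zero_add] at key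
    simp only [Nat.cast_zero, zero_mul, mul_zero, zero_add] at key
    refine key.congr_deriv (tsum_congr fun n => ?_)
    simp only [Nat.add_sub_cancel, Nat.cast_add, Nat.cast_one]
    ring
  · intro n y hy
    have hy' : |y| ≤ r := (abs_lt.2 hy).le
    rw [Real.norm_eq_abs, abs_mul, abs_mul, abs_mul, abs_mul, abs_pow, abs_pow, abs_of_pos hr0]
    gcongr
  · exact ⟨by linarith, hr0⟩
  · exact abs_lt.1 hzr

/-! ### The hypergeometric series and its differential equation -/

/-- The coefficient `((1/3, n) / n!)²` of `F(1/3, 1/3; 1; ·)`. -/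
noncomputable def cubicCoeff (n : ℕ) : ℝ :=
  ((ascPochhammer ℝ n).eval (1 / 3)) ^ 2 / (n.factorial : ℝ) ^ 2

theorem cubicCoeff_zero : cubicCoeff 0 = 1 := by simp [cubicCoeff]

theorem cubicCoeff_nonneg (n : ℕ) : 0 ≤ cubicCoeff n := by unfold cubicCoeff; positivity

theorem cubicCoeff_succ (n : ℕ) :
    ((n : ℝ) + 1) ^ 2 * cubicCoeff (n + 1) = ((n : ℝ) + 1 / 3) ^ 2 * cubicCoeff n := by
  unfold cubicCoeff
  rw [ascPochhammer_succ_eval, Nat.factorial_succ]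
  have : (n.factorial : ℝ) ≠ 0 := by exact_mod_cast n.factorial_ne_zero
  push_cast
  field_simp
  ring

theorem cubicCoeff_le_one (n : ℕ) : cubicCoeff n ≤ 1 := by
  induction n with
  | zero => exact cubicCoeff_zero.le
  | succ n ih =>
    have h := cubicCoeff_succ n
    have hn : (0 : ℝ) ≤ n := n.cast_nonneg
    have h0 := cubicCoeff_nonneg n
    have h1 : ((n : ℝ) + 1 / 3) ^ 2 * cubicCoeff n ≤ ((n : ℝ) + 1) ^ 2 * 1 := by
      gcongr
      norm_num
    rw [← h] at h1
    exact le_of_mul_le_mul_left h1 (by positivity)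

theorem abs_cubicCoeff_le (n : ℕ) : |cubicCoeff n| ≤ 1 * ((n : ℝ) + 1) ^ 0 := by
  rw [abs_of_nonneg (cubicCoeff_nonneg n)]
  simpa using cubicCoeff_le_one n

/-- `F(1/3, 1/3; 1; z)` as a power series. -/
noncomputable def cubicHyp (z : ℝ) : ℝ := ∑' n, cubicCoeff n * z ^ n

/-- The termwise derivative of `cubicHyp`. -/
noncomputable def cubicHypDeriv (z : ℝ) : ℝ := ∑' n : ℕ, (((n : ℝ) + 1) * cubicCoeff (n + 1)) * z ^ n

/-- The termwise second derivative of `cubicHyp`. -/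
noncomputable def cubicHypDeriv₂ (z : ℝ) : ℝ :=
  ∑' n : ℕ, (((n : ℝ) + 1) * ((((n + 1 : ℕ) : ℝ) + 1) * cubicCoeff (n + 1 + 1))) * z ^ n

theorem hasSum_cubicHyp {z : ℝ} (hz : |z| < 1) :
    HasSum (fun n => cubicCoeff n * z ^ n) (cubicHyp z) :=
  (summable_mul_pow_of_abs_le abs_cubicCoeff_le hz).hasSum

theorem hasDerivAt_cubicHyp {z : ℝ} (hz : |z| < 1) : HasDerivAt cubicHyp (cubicHypDeriv z) z :=
  hasDerivAt_tsum_mul_pow abs_cubicCoeff_le hz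

theorem hasDerivAt_cubicHypDeriv {z : ℝ} (hz : |z| < 1) :
    HasDerivAt cubicHypDeriv (cubicHypDeriv₂ z) z :=
  hasDerivAt_tsum_mul_pow (a := fun n : ℕ => ((n : ℝ) + 1) * cubicCoeff (n + 1))
    (abs_succ_mul_succ_le abs_cubicCoeff_le) hz

theorem cubicHyp_zero : cubicHyp 0 = 1 := by
  rw [cubicHyp, tsum_eq_single 0 fun n hn => by simp [hn]]
  simp [cubicCoeff_zero]

theorem one_le_cubicHyp {z : ℝ} (h0 : 0 ≤ z) (h1 : z < 1) : 1 ≤ cubicHyp z := by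
  have h := (hasSum_cubicHyp (z := z) (by rwa [abs_of_nonneg h0])).summable.sum_le_tsum {0}
    fun n _ => mul_nonneg (cubicCoeff_nonneg n) (pow_nonneg h0 n)
  simpa [cubicCoeff_zero, cubicHyp] using h

theorem ordinaryHypergeometric_one_third_eq (z : ℝ) :
    ordinaryHypergeometric (1 / 3 : ℝ) (1 / 3 : ℝ) (1 : ℝ) z = cubicHyp z := by
  rw [ordinaryHypergeometric_eq_tsum, cubicHyp]
  refine tsum_congr fun n => ?_
  have : (n.factorial : ℝ) ≠ 0 := by exact_mod_cast n.factorial_ne_zero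
  rw [ascPochhammer_eval_one, cubicCoeff, smul_eq_mul]
  field_simp

/-- The hypergeometric differential equation for `F(1/3, 1/3; 1; ·)`. -/
theorem cubicHyp_ode {z : ℝ} (hz : |z| < 1) :
    z * (1 - z) * cubicHypDeriv₂ z + (1 - 5 / 3 * z) * cubicHypDeriv z - 1 / 9 * cubicHyp z = 0 := by
  have h0 := hasSum_cubicHyp hz
  have b1 := abs_succ_mul_succ_le abs_cubicCoeff_le
  have h1 : HasSum _ (cubicHypDeriv z) := (summable_mul_pow_of_abs_le b1 hz).hasSum
  have h2 : HasSum _ (cubicHypDeriv₂ z) := (summable_mul_pow_of_abs_le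
    (abs_succ_mul_succ_le (a := fun n : ℕ => ((n : ℝ) + 1) * cubicCoeff (n + 1)) b1) hz).hasSum
  have e1 : HasSum (fun n : ℕ => (n : ℝ) * cubicCoeff n * z ^ n) (z * cubicHypDeriv z) := by
    rw [← hasSum_nat_add_iff' 1]
    simp only [Finset.range_one, Finset.sum_singleton, Nat.cast_zero, zero_mul, sub_zero]
    refine (h1.mul_left z).congr_fun fun n => ?_
    push_cast
    ring
  have e2 : HasSum (fun n : ℕ => (n : ℝ) * ((n : ℝ) + 1) * cubicCoeff (n + 1) * z ^ n)
      (z * cubicHypDeriv₂ z) := by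
    rw [← hasSum_nat_add_iff' 1]
    simp only [Finset.range_one, Finset.sum_singleton, Nat.cast_zero, zero_mul, sub_zero]
    refine (h2.mul_left z).congr_fun fun n => ?_
    push_cast
    ring
  have e3 : HasSum (fun n : ℕ => (n : ℝ) * ((n : ℝ) - 1) * cubicCoeff n * z ^ n)
      (z * (z * cubicHypDeriv₂ z)) := by
    rw [← hasSum_nat_add_iff' 1]
    simp only [Finset.range_one, Finset.sum_singleton, Nat.cast_zero, zero_mul, sub_zero]
    refine (e2.mul_left z).congr_fun fun n => ?_
    push_cast
    ring
  have key := (((e2.sub e3).add h1).sub (e1.mul_left (5 / 3))).sub (h0.mul_left (1 / 9))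
  -- The coefficient of `z ^ n` is `(n + 1)² cₙ₊₁ - (n + 1/3)² cₙ`, where `c` is `cubicCoeff`.
  have hzero : HasSum (fun _ : ℕ => (0 : ℝ)) _ := key.congr_fun fun n => by
    linear_combination (-z ^ n) * cubicCoeff_succ n
  linear_combination hzero.unique hasSum_zero

/-! ### The cubic transformation -/

/-- The right-hand side of the cubic transformation of `F(1/3, 1/3; 1; 1 - x³)`. -/
noncomputable def cubicHypTransform (x : ℝ) : ℝ :=
  (3 / (x ^ 2 + x + 1)) ^ ((1 : ℝ) / 3) * cubicHyp ((1 - x) ^ 3 / (9 * (x ^ 2 + x + 1)))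

/-- `(1 - x³)` times the derivative of `cubicHypTransform`. -/
noncomputable def cubicHypTransformDeriv (x : ℝ) : ℝ :=
  (3 / (x ^ 2 + x + 1)) ^ ((1 : ℝ) / 3) *
    (-(1 - x) * (2 * x + 1) / 3 * cubicHyp ((1 - x) ^ 3 / (9 * (x ^ 2 + x + 1))) -
      (1 - x) ^ 3 / (9 * (x ^ 2 + x + 1)) * (x + 2) ^ 2 *
        cubicHypDeriv ((1 - x) ^ 3 / (9 * (x ^ 2 + x + 1))))

theorem abs_one_sub_cube_lt_one {x : ℝ} (hx : x ∈ Set.Ioc (0 : ℝ) 1) : |1 - x ^ 3| < 1 := by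
  have h0 : 0 < x ^ 3 := pow_pos hx.1 3
  have h1 : x ^ 3 ≤ 1 := pow_le_one₀ hx.1.le hx.2
  rw [abs_lt]
  constructor <;> linarith

theorem abs_transform_arg_lt_one {x : ℝ} (hx : x ∈ Set.Ioc (0 : ℝ) 1) :
    |(1 - x) ^ 3 / (9 * (x ^ 2 + x + 1))| < 1 := by
  obtain ⟨h0, h1⟩ := hx
  have h2 : 0 ≤ 1 - x := by linarith
  rw [abs_of_nonneg (by positivity), div_lt_one (by positivity)]
  nlinarith [pow_le_one₀ (n := 3) h2 (by linarith)]

theorem hasDerivAt_cubeRoot_factor {x : ℝ} (hx : 0 < x) :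
    HasDerivAt (fun y : ℝ => (3 / (y ^ 2 + y + 1)) ^ ((1 : ℝ) / 3))
      ((3 / (x ^ 2 + x + 1)) ^ ((1 : ℝ) / 3) * (-(2 * x + 1) / (3 * (x ^ 2 + x + 1)))) x := by
  have hs : 0 < x ^ 2 + x + 1 := by positivity
  have h1 : HasDerivAt (fun y : ℝ => y ^ 2 + y + 1) (2 * x + 1) x := by
    simpa using ((hasDerivAt_pow 2 x).add (hasDerivAt_id x)).add_const (1 : ℝ)
  have h2 := ((hasDerivAt_const x (3 : ℝ)).div h1 hs.ne').rpow_const (p := (1 : ℝ) / 3)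
    (Or.inl (div_pos three_pos hs).ne')
  refine h2.congr_deriv ?_
  rw [Pi.div_apply, Real.rpow_sub_one (by positivity)]
  field_simp
  ring

theorem hasDerivAt_transform_arg {x : ℝ} (hx : 0 < x) :
    HasDerivAt (fun y : ℝ => (1 - y) ^ 3 / (9 * (y ^ 2 + y + 1)))
      (-((1 - x) ^ 2 * (x + 2) ^ 2) / (9 * (x ^ 2 + x + 1) ^ 2)) x := by
  have hs : 0 < x ^ 2 + x + 1 := by positivity
  have h1 : HasDerivAt (fun y : ℝ => 9 * (y ^ 2 + y + 1)) (9 * (2 * x + 1)) x := by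
    simpa using (((hasDerivAt_pow 2 x).add (hasDerivAt_id x)).add_const (1 : ℝ)).const_mul 9
  have h2 : HasDerivAt (fun y : ℝ => (1 - y) ^ 3) (-(3 * (1 - x) ^ 2)) x := by
    simpa using ((hasDerivAt_id' x).const_sub 1).fun_pow 3
  refine (h2.div h1 (by positivity)).congr_deriv ?_
  field_simp
  ring

theorem hasDerivAt_one_sub_cube (x : ℝ) : HasDerivAt (fun y : ℝ => 1 - y ^ 3) (-(3 * x ^ 2)) x := by
  simpa using (hasDerivAt_pow 3 x).const_sub 1

theorem hasDerivAt_cubicHyp_one_sub_cube {x : ℝ} (hx : x ∈ Set.Ioc (0 : ℝ) 1) :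
    HasDerivAt (fun y : ℝ => cubicHyp (1 - y ^ 3)) (cubicHypDeriv (1 - x ^ 3) * -(3 * x ^ 2)) x :=
  (hasDerivAt_cubicHyp (abs_one_sub_cube_lt_one hx)).comp (h := fun y : ℝ => 1 - y ^ 3) x
    (hasDerivAt_one_sub_cube x)

/-- This is `9 x` times the hypergeometric equation at `z = 1 - x³`, put in self-adjoint form. -/
theorem hasDerivAt_flux_cubicHyp {x : ℝ} (hx : x ∈ Set.Ioc (0 : ℝ) 1) :
    HasDerivAt (fun y : ℝ => (1 - y ^ 3) * (cubicHypDeriv (1 - y ^ 3) * -(3 * y ^ 2)))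
      (x * cubicHyp (1 - x ^ 3)) x := by
  have hz := abs_one_sub_cube_lt_one hx
  have h1 := (hasDerivAt_cubicHypDeriv hz).comp x (hasDerivAt_one_sub_cube x)
  have h2 : HasDerivAt (fun y : ℝ => -(3 * y ^ 2)) (-(3 * (2 * x))) x := by
    simpa using ((hasDerivAt_pow 2 x).const_mul 3).fun_neg
  refine ((hasDerivAt_one_sub_cube x).mul (h1.mul h2)).congr_deriv ?_
  simp only [Function.comp_apply, Pi.mul_apply]
  linear_combination 9 * x * cubicHyp_ode hz

theorem hasDerivAt_cubicHypTransform {x : ℝ} (hx : x ∈ Set.Ioo (0 : ℝ) 1) :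
    HasDerivAt cubicHypTransform (cubicHypTransformDeriv x / (1 - x ^ 3)) x := by
  have hw := abs_transform_arg_lt_one (Set.Ioo_subset_Ioc_self hx)
  have hs : 0 < x ^ 2 + x + 1 := by have := hx.1; positivity
  have hP : 1 - x ^ 3 = (1 - x) * (x ^ 2 + x + 1) := by ring
  have h1 : 0 < 1 - x := by linarith [hx.2]
  have h := (hasDerivAt_cubeRoot_factor hx.1).mul
    ((hasDerivAt_cubicHyp hw).comp x (hasDerivAt_transform_arg hx.1))
  refine h.congr_deriv ?_
  simp only [Function.comp_apply, cubicHypTransformDeriv]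
  rw [hP]
  generalize cubicHyp _ = G
  generalize cubicHypDeriv _ = G'
  generalize (3 / (x ^ 2 + x + 1)) ^ ((1 : ℝ) / 3) = c
  obtain ⟨s, hsx⟩ : ∃ s, s = x ^ 2 + x + 1 := ⟨_, rfl⟩
  rw [← hsx] at hs ⊢
  field_simp
  ring

theorem continuousAt_cubicHypTransform {x : ℝ} (hx : x ∈ Set.Ioc (0 : ℝ) 1) :
    ContinuousAt cubicHypTransform x :=
  ((hasDerivAt_cubeRoot_factor hx.1).continuousAt).mul
    ((hasDerivAt_cubicHyp (abs_transform_arg_lt_one hx)).continuousAt.comp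
      (f := fun y : ℝ => (1 - y) ^ 3 / (9 * (y ^ 2 + y + 1)))
      (hasDerivAt_transform_arg hx.1).continuousAt)

theorem hasDerivAt_cubicHypTransformDeriv {x : ℝ} (hx : x ∈ Set.Ioc (0 : ℝ) 1) :
    HasDerivAt cubicHypTransformDeriv (x * cubicHypTransform x) x := by
  have hw := abs_transform_arg_lt_one hx
  have hs : 0 < x ^ 2 + x + 1 := by have := hx.1; positivity
  have hwd := hasDerivAt_transform_arg hx.1
  have hA : HasDerivAt (fun y : ℝ => -(1 - y) * (2 * y + 1) / 3) ((4 * x - 1) / 3) x := by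
    have h1 : HasDerivAt (fun y : ℝ => -(1 - y)) 1 x := by
      exact ((hasDerivAt_id' x).const_sub 1).fun_neg.congr_deriv (by norm_num)
    have h2 : HasDerivAt (fun y : ℝ => 2 * y + 1) 2 x := by
      simpa using ((hasDerivAt_id x).const_mul 2).add_const 1
    exact ((h1.mul h2).div_const 3).congr_deriv (by ring)
  have hB : HasDerivAt (fun y : ℝ => (y + 2) ^ 2) (2 * (x + 2)) x := by
    simpa using ((hasDerivAt_id' x).add_const 2).fun_pow 2
  have h := (hasDerivAt_cubeRoot_factor hx.1).mul
    ((hA.mul ((hasDerivAt_cubicHyp hw).comp x hwd)).sub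
      ((hwd.mul hB).mul ((hasDerivAt_cubicHypDeriv hw).comp x hwd)))
  refine h.congr_deriv ?_
  have hode := cubicHyp_ode hw
  simp only [Function.comp_apply, Pi.mul_apply, Pi.sub_apply, cubicHypTransform]
  generalize cubicHyp _ = G at *
  generalize cubicHypDeriv _ = G' at *
  generalize cubicHypDeriv₂ _ = G'' at *
  generalize (3 / (x ^ 2 + x + 1)) ^ ((1 : ℝ) / 3) = c
  obtain ⟨s, hsx⟩ : ∃ s, s = x ^ 2 + x + 1 := ⟨_, rfl⟩
  rw [← hsx] at hs hode ⊢
  rw [← sub_eq_zero]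
  -- The discrepancy is this multiple of the hypergeometric equation at the transformed argument.
  refine Eq.trans ?_ ((congrArg (c * ((1 - x) ^ 2 * (x + 2) / s) * ·) hode).trans (mul_zero _))
  have hs0 := hs.ne'
  field_simp
  subst hsx
  ring

/-- `cubicHyp (1 - x³)` and `cubicHypTransform` solve the same equation
`((1 - x³) y')' = x y`, whose Wronskian vanishes at `1`. -/
theorem wronskian_eq_zero {x : ℝ} (hx : x ∈ Set.Ioc (0 : ℝ) 1) :
    (1 - x ^ 3) * (cubicHypDeriv (1 - x ^ 3) * -(3 * x ^ 2)) * cubicHypTransform x =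
      cubicHyp (1 - x ^ 3) * cubicHypTransformDeriv x := by
  have hmem : ∀ y ∈ Set.Icc x 1, y ∈ Set.Ioc (0 : ℝ) 1 := fun y hy => ⟨hx.1.trans_le hy.1, hy.2⟩
  have h := constant_of_has_deriv_right_zero (a := x) (b := 1)
    (f := fun y => (1 - y ^ 3) * (cubicHypDeriv (1 - y ^ 3) * -(3 * y ^ 2)) * cubicHypTransform y -
      cubicHyp (1 - y ^ 3) * cubicHypTransformDeriv y)
    (fun y hy => (((hasDerivAt_flux_cubicHyp (hmem y hy)).continuousAt.mul
      (continuousAt_cubicHypTransform (hmem y hy))).sub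
      ((hasDerivAt_cubicHyp_one_sub_cube (hmem y hy)).continuousAt.mul
      (hasDerivAt_cubicHypTransformDeriv (hmem y hy)).continuousAt)).continuousWithinAt)
    (fun y hy => by
      have hy1 := hmem y ⟨hy.1, hy.2.le⟩
      have hP : 1 - y ^ 3 ≠ 0 := by
        have := pow_lt_one₀ hy1.1.le hy.2 three_ne_zero
        linarith
      refine (((hasDerivAt_flux_cubicHyp hy1).mul
        (hasDerivAt_cubicHypTransform ⟨hy1.1, hy.2⟩)).sub
        ((hasDerivAt_cubicHyp_one_sub_cube hy1).mul
        (hasDerivAt_cubicHypTransformDeriv hy1))).hasDerivWithinAt.congr_deriv ?_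
      field_simp
      ring)
    1 ⟨hx.2, le_rfl⟩
  rw [← sub_eq_zero]
  refine h.symm.trans ?_
  -- Both terms carry a factor that vanishes at `1`.
  simp [cubicHypTransformDeriv]

/-- A zero Wronskian makes the quotient of the two solutions constant. Right derivatives on `[x, 1)`
with continuity up to `1` suffice, so no derivative is needed at the singular point. -/
theorem cubicHyp_one_sub_cube_eq {x : ℝ} (hx : x ∈ Set.Ioc (0 : ℝ) 1) :
    cubicHyp (1 - x ^ 3) = cubicHypTransform x := by
  have hmem : ∀ y ∈ Set.Icc x 1, y ∈ Set.Ioc (0 : ℝ) 1 := fun y hy => ⟨hx.1.trans_le hy.1, hy.2⟩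
  have hpos : ∀ y ∈ Set.Ioc (0 : ℝ) 1, 0 < cubicHyp (1 - y ^ 3) := fun y hy =>
    zero_lt_one.trans_le (one_le_cubicHyp (by linarith [pow_le_one₀ (n := 3) hy.1.le hy.2])
      (by linarith [pow_pos hy.1 3]))
  have h := constant_of_has_deriv_right_zero (a := x) (b := 1)
    (f := fun y => cubicHypTransform y / cubicHyp (1 - y ^ 3))
    (fun y hy => ((continuousAt_cubicHypTransform (hmem y hy)).div
      (hasDerivAt_cubicHyp_one_sub_cube (hmem y hy)).continuousAt
      (hpos y (hmem y hy)).ne').continuousWithinAt)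
    (fun y hy => by
      have hy1 := hmem y ⟨hy.1, hy.2.le⟩
      have hP : 1 - y ^ 3 ≠ 0 := by
        have := pow_lt_one₀ hy1.1.le hy.2 three_ne_zero
        linarith
      have hf := (hpos y hy1).ne'
      refine ((hasDerivAt_cubicHypTransform ⟨hy1.1, hy.2⟩).div
        (hasDerivAt_cubicHyp_one_sub_cube hy1) hf).hasDerivWithinAt.congr_deriv ?_
      have hw := wronskian_eq_zero hy1
      rw [div_eq_zero_iff]
      left
      field_simp
      linear_combination -hw)
    1 ⟨hx.2, le_rfl⟩
  have h1 : cubicHypTransform 1 / cubicHyp (1 - 1 ^ 3) = 1 := by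
    norm_num [cubicHypTransform, cubicHyp_zero]
  have h2 := h1.symm.trans h
  rw [eq_div_iff (hpos x hx).ne', one_mul] at h2
  exact h2

/-! ### The iteration and its limit -/

theorem cubicAGMSeqA_succ (a b : ℝ) (n : ℕ) :
    cubicAGMSeqA a b (n + 1) = (cubicAGMSeqA a b n + 2 * cubicAGMSeqB a b n) / 3 := rfl

theorem cubicAGMSeqB_succ (a b : ℝ) (n : ℕ) :
    cubicAGMSeqB a b (n + 1) = (cubicAGMSeqB a b n * (cubicAGMSeqA a b n ^ 2 +
      cubicAGMSeqA a b n * cubicAGMSeqB a b n + cubicAGMSeqB a b n ^ 2) / 3) ^ ((1 : ℝ) / 3) := rfl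

theorem rpow_one_third_pow_three {y : ℝ} (hy : 0 ≤ y) : (y ^ ((1 : ℝ) / 3)) ^ 3 = y := by
  rw [← Real.rpow_natCast, ← Real.rpow_mul hy]
  norm_num

theorem cubicAGM_step_lt {a b : ℝ} (ha : 0 < a) (hab : a < b) :
    a < (a + 2 * b) / 3 ∧
    (a + 2 * b) / 3 < (b * (a ^ 2 + a * b + b ^ 2) / 3) ^ ((1 : ℝ) / 3) ∧
    (b * (a ^ 2 + a * b + b ^ 2) / 3) ^ ((1 : ℝ) / 3) < b := by
  have hb : 0 < b := ha.trans hab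
  have hc := rpow_one_third_pow_three (y := b * (a ^ 2 + a * b + b ^ 2) / 3) (by positivity)
  refine ⟨by linarith, ?_, ?_⟩
  · refine lt_of_pow_lt_pow_left₀ 3 (by positivity) ?_
    rw [hc]
    -- The difference of the cubes is `(b - a)³ / 27`.
    linarith [pow_pos (sub_pos.2 hab) 3]
  · refine lt_of_pow_lt_pow_left₀ 3 hb.le ?_
    rw [hc]
    have h1 : a ^ 2 < b ^ 2 := by gcongr
    have h2 : a * b < b * b := by gcongr
    have h3 := mul_lt_mul_of_pos_left (add_lt_add h1 h2) hb
    linarith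

/-- Put `x = a / b` in the cubic transformation: its argument is `1 - (a₁/b₁)³` and its prefactor is
`b / b₁`, where `a₁`, `b₁` are the next terms. -/
theorem cubicHyp_step {a b : ℝ} (ha : 0 < a) (hab : a < b) :
    cubicHyp (1 - (((a + 2 * b) / 3) / (b * (a ^ 2 + a * b + b ^ 2) / 3) ^ ((1 : ℝ) / 3)) ^ 3) /
      (b * (a ^ 2 + a * b + b ^ 2) / 3) ^ ((1 : ℝ) / 3) = cubicHyp (1 - (a / b) ^ 3) / b := by
  have hb : 0 < b := ha.trans hab
  rw [cubicHyp_one_sub_cube_eq ⟨div_pos ha hb, ((div_lt_one hb).2 hab).le⟩, cubicHypTransform,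
    div_pow _ _ 3, rpow_one_third_pow_three (by positivity)]
  have e1 : 1 - ((a + 2 * b) / 3) ^ 3 / (b * (a ^ 2 + a * b + b ^ 2) / 3) =
      (1 - a / b) ^ 3 / (9 * ((a / b) ^ 2 + a / b + 1)) := by
    field_simp
    ring
  have e2 : b = (b ^ 3) ^ ((1 : ℝ) / 3) := by
    rw [← Real.rpow_natCast, ← Real.rpow_mul hb.le]
    norm_num
  have e3 : (3 / ((a / b) ^ 2 + a / b + 1)) ^ ((1 : ℝ) / 3) / b =
      ((b * (a ^ 2 + a * b + b ^ 2) / 3) ^ ((1 : ℝ) / 3))⁻¹ := by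
    nth_rewrite 3 [e2]
    rw [← Real.div_rpow (by positivity) (by positivity), ← Real.inv_rpow (by positivity)]
    congr 1
    field_simp
  rw [e1, div_eq_inv_mul, ← e3, div_mul_eq_mul_div]

section Iteration

variable {a b : ℝ}

theorem cubicAGMSeq_pos_lt (ha : 0 < a) (hab : a < b) (n : ℕ) :
    0 < cubicAGMSeqA a b n ∧ cubicAGMSeqA a b n < cubicAGMSeqB a b n := by
  induction n with
  | zero => exact ⟨ha, hab⟩
  | succ n ih =>
    obtain ⟨h1, h2, -⟩ := cubicAGM_step_lt ih.1 ih.2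
    rw [cubicAGMSeqA_succ, cubicAGMSeqB_succ]
    exact ⟨ih.1.trans h1, h2⟩

theorem monotone_cubicAGMSeqA (ha : 0 < a) (hab : a < b) : Monotone (cubicAGMSeqA a b) :=
  monotone_nat_of_le_succ fun n =>
    (cubicAGM_step_lt (cubicAGMSeq_pos_lt ha hab n).1 (cubicAGMSeq_pos_lt ha hab n).2).1.le

theorem antitone_cubicAGMSeqB (ha : 0 < a) (hab : a < b) : Antitone (cubicAGMSeqB a b) :=
  antitone_nat_of_succ_le fun n =>
    (cubicAGM_step_lt (cubicAGMSeq_pos_lt ha hab n).1 (cubicAGMSeq_pos_lt ha hab n).2).2.2.le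

theorem tendsto_cubicAGMSeqA (ha : 0 < a) (hab : a < b) :
    Tendsto (cubicAGMSeqA a b) atTop (𝓝 (cubicAGM a b)) := by
  refine tendsto_nhds_limUnder ⟨_, tendsto_atTop_ciSup (monotone_cubicAGMSeqA ha hab) ⟨b, ?_⟩⟩
  rintro _ ⟨n, rfl⟩
  exact (cubicAGMSeq_pos_lt ha hab n).2.le.trans (antitone_cubicAGMSeqB ha hab n.zero_le)

theorem tendsto_cubicAGMSeqB (ha : 0 < a) (hab : a < b) :
    Tendsto (cubicAGMSeqB a b) atTop (𝓝 (cubicAGM a b)) := by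
  have hA := tendsto_cubicAGMSeqA ha hab
  -- Since `2 bₙ = 3 aₙ₊₁ - aₙ`, the limit of `aₙ` alone determines that of `bₙ`.
  have h := (((hA.comp (tendsto_add_atTop_nat 1)).const_mul 3).sub hA).div_const 2
  convert h using 2
  · simp only [Function.comp_apply, cubicAGMSeqA_succ]
    ring
  · ring

theorem cubicAGM_pos (ha : 0 < a) (hab : a < b) : 0 < cubicAGM a b :=
  ha.trans_le ((monotone_cubicAGMSeqA ha hab).ge_of_tendsto (tendsto_cubicAGMSeqA ha hab) 0)

theorem cubicHyp_seq_eq (ha : 0 < a) (hab : a < b) (n : ℕ) :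
    cubicHyp (1 - (cubicAGMSeqA a b n / cubicAGMSeqB a b n) ^ 3) / cubicAGMSeqB a b n =
      cubicHyp (1 - (a / b) ^ 3) / b := by
  induction n with
  | zero => rfl
  | succ n ih =>
    rw [← ih, cubicAGMSeqA_succ, cubicAGMSeqB_succ]
    exact cubicHyp_step (cubicAGMSeq_pos_lt ha hab n).1 (cubicAGMSeq_pos_lt ha hab n).2

theorem one_div_cubicAGM_eq (ha : 0 < a) (hab : a < b) :
    1 / cubicAGM a b = cubicHyp (1 - (a / b) ^ 3) / b := by
  have hM := (cubicAGM_pos ha hab).ne'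
  have hA := tendsto_cubicAGMSeqA ha hab
  have hB := tendsto_cubicAGMSeqB ha hab
  have harg : Tendsto (fun n => 1 - (cubicAGMSeqA a b n / cubicAGMSeqB a b n) ^ 3) atTop (𝓝 0) := by
    simpa [div_self hM] using ((hA.div hB hM).pow 3).const_sub 1
  have hG : Tendsto cubicHyp (𝓝 0) (𝓝 1) := by
    simpa [cubicHyp_zero] using (hasDerivAt_cubicHyp (z := 0) (by simp)).continuousAt.tendsto
  have h := (hG.comp harg).div hB hM
  refine tendsto_nhds_unique h (tendsto_const_nhds.congr fun n => ?_)
  exact (cubicHyp_seq_eq ha hab n).symm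

end Iteration

theorem theorem1p4 (x : ℝ) (hx : x ∈ Set.Ioo (0 : ℝ) 1) :
    (Tendsto (cubicAGMSeqA x 1) atTop (𝓝 (cubicAGM x 1)) ∧
      Tendsto (cubicAGMSeqB x 1) atTop (𝓝 (cubicAGM x 1))) ∧
    0 < cubicAGM x 1 ∧
    HasSum
      (fun n : ℕ => ((ascPochhammer ℝ n).eval (1 / 3)) ^ 2 / (n.factorial : ℝ) ^ 2
        * (1 - x ^ 3) ^ n)
      (1 / cubicAGM x 1) ∧
    1 / cubicAGM x 1 = ordinaryHypergeometric (1 / 3 : ℝ) (1 / 3 : ℝ) (1 : ℝ) (1 - x ^ 3) ∧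
    ordinaryHypergeometric (1 / 3 : ℝ) (1 / 3 : ℝ) (1 : ℝ) (1 - x ^ 3) =
      (3 / (x ^ 2 + x + 1)) ^ ((1 : ℝ) / 3) *
        ordinaryHypergeometric (1 / 3 : ℝ) (1 / 3 : ℝ) (1 : ℝ)
          ((1 - x) ^ 3 / (9 * (x ^ 2 + x + 1))) := by
  have hx' := Set.Ioo_subset_Ioc_self hx
  have hM : 1 / cubicAGM x 1 = cubicHyp (1 - x ^ 3) := by
    simpa using one_div_cubicAGM_eq hx.1 hx.2
  simp only [ordinaryHypergeometric_one_third_eq]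
  exact ⟨⟨tendsto_cubicAGMSeqA hx.1 hx.2, tendsto_cubicAGMSeqB hx.1 hx.2⟩, cubicAGM_pos hx.1 hx.2,
    hM ▸ hasSum_cubicHyp (abs_one_sub_cube_lt_one hx'), hM, cubicHyp_one_sub_cube_eq hx'⟩
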